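/- Fix $d\in\{1,2\}$ and a lattice $\Lambda=\{0,\dots,H-1\}^d$ of $N=H^d$ sites, each carrying a particle with an $M$-dimensional local Hilbert space. An overlapping convolutional arithmetic circuit of depth $L\ge 1$, kernel size $K^d$ ($K\ge 2$) and stride $1$, with $r_l$ channels in layer $l$ ($r_0=M$), acts as follows on inputs $x^{0}_p\in\mathbb{R}^{M}$, $p\in\Lambda$. For $l=1,\dots,L$ it computes $$x^{l}_{p}=\bigodot_{k\in\{0,\dots,K-1\}^d,\ q_k\in\Lambda}W^{(k,l)}x^{l-1}_{q_k},\qquad q_k=p+k-\lfloor K/2\rfloor(1,\dots,1),\qquad p\in\Lambda,$$ where $\odot$ is the entrywise product, the weight matrices $W^{(k,l)}\in\mathbb{R}^{r_l\times r_{l-1}}$ are shared by all sites, and window positions $q_k$ outside $\Lambda$ contribute no factor. A global product pooling layer then gives the scalar output $y=\prod_{p\in\Lambda}\langle w^{(p)},x^{L}_{p}\rangle$ with weights $w^{(p)}\in\mathbb{R}^{r_L}$. The network represents the (unnormalized) state $$|\psi\rangle=\sum_{s\in\{1,\dots,M\}^{\Lambda}}y\big((\hat e^{(s_p)})_{p\in\Lambda}\big)\,|\hat\psi_s\rangle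 ,$$ where $\hat e^{(1)},\dots,\hat e^{(M)}$ is the standard basis of $\mathbb{R}^M$ and $(|\hat\psi_s\rangle)_s$ is the product orthonormal basis of the many-body Hilbert space. For $A\subseteq\Lambda$ with complement $B$, let $maxEE_A$ be the supremum, over all network parameters $(W^{(k,l)},w^{(p)})$ for which $\psi\neq 0$, of the entanglement entropy $-\mathrm{Tr}(\rho_A\log\rho_A)$, where $\rho_A=\mathrm{Tr}_B|\psi\rangle\langle\psi|/\|\psi\|^2$. **Theorem.** There is an absolute constant $c>0$ such that the following holds for all $d\in\{1,2\}$, $H$, $K\ge 2$, $L\ge1$, $\alpha\ge 1$ and all widths with $M=r_0\ge 2$ and $r_1,\dots,r_L\ge 2$. Let $A\subseteq\Lambda$ be an interval of $\alpha$ sites ($d=1$) or an $\alpha\times\alpha$ square ($d=2$), at any place in the lattice, with complement $B$ such that $|A|\le|B|$. Then $$maxEE_A\ \ge\ c\,\min\{\alpha^{d},\,LK\alpha^{d-1}\}.$$ In particular, the network supports volume-law entanglement, $maxEE_A\ge c\,\alpha^d$, whenever $\alpha<LK$. -/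

import Mathlib

open scoped Matrix

noncomputable section

namespace OverlapCAC

/-- The sites of a `d`-dimensional lattice of linear size `H` (so `N = H ^ d` particles). -/
abbrev Site (d H : ℕ) : Type := Fin d → Fin H

/-- The positions inside a convolution kernel of size `K ^ d`. -/
abbrev Offset (d K : ℕ) : Type := Fin d → Fin K

/-- A feature map with `m` channels: a vector in `ℝ ^ m` at every site. -/
abbrev FeatureMap (d H m : ℕ) : Type := Site d H → Fin m → ℝ

/-- A convolution layer with product pooling, stride `1`, kernel size `K ^ d` and weight matrices
`W k`, one for each position `k` in the kernel and shared between all sites: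
`(output p)_c = ∏ k, (W k *ᵥ x q)_c`, where `q = p + k - ⌊K / 2⌋` (in every coordinate), so the
window is centred at `p`. Positions `q` of the window that lie outside the lattice
contribute no factor: the inner product ranges over at most one site, and is `1` if there is none.
The output is produced at every site, the edges included. -/
def convLayer {d H K m n : ℕ} (W : Offset d K → Matrix (Fin n) (Fin m) ℝ)
    (x : FeatureMap d H m) : FeatureMap d H n :=
  fun p c => ∏ k : Offset d K,
    ∏ q : Site d H with (∀ i, (q i : ℕ) + K / 2 = (p i : ℕ) + (k i : ℕ)), (W k *ᵥ x q) c

/-- The parameters of a network of depth `L` with `r l` channels in layer `l`; layer `0` is the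
input, so `r 0` is the dimension `M` of the local Hilbert space. There are `L` convolution layers,
and a global pooling layer whose receptive field is the whole lattice, with one output channel and
hence one weight row vector for each site. -/
structure Params (d H K L : ℕ) (r : ℕ → ℕ) where
  /-- The convolution weights. -/
  conv : (l : Fin L) → Offset d K → Matrix (Fin (r ((l : ℕ) + 1))) (Fin (r (l : ℕ))) ℝ
  /-- The weights of the global pooling layer. -/
  pool : Site d H → Fin (r L) → ℝ

/-- The output of layer `l`, for the input `x`. -/
def layerOut {d H K L : ℕ} {r : ℕ → ℕ} (θ : Params d H K L r) (x : FeatureMap d H (r 0)) :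
    (l : ℕ) → l ≤ L → FeatureMap d H (r l)
  | 0, _ => x
  | l + 1, h => convLayer (θ.conv ⟨l, h⟩) (layerOut θ x l (Nat.le_of_succ_le h))

/-- The scalar output `y` of the network: global product pooling, applied to layer `L`. -/
def output {d H K L : ℕ} {r : ℕ → ℕ} (θ : Params d H K L r) (x : FeatureMap d H (r 0)) : ℝ :=
  ∏ p : Site d H, θ.pool p ⬝ᵥ layerOut θ x L le_rfl p

/-- The (unnormalized) many-body state of the network, in coordinates with respect to the product
orthonormal basis: the amplitude of `s` is the output of the network on the standard basis
vectors `e_{s p}`. -/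
def state {d H K L : ℕ} {r : ℕ → ℕ} (θ : Params d H K L r) :
    EuclideanSpace ℂ (Site d H → Fin (r 0)) :=
  WithLp.toLp 2 fun s => (output θ (fun p => Pi.single (s p) 1) : ℂ)

section Entanglement

variable {ι : Type} [Fintype ι] [DecidableEq ι] {M : ℕ}

/-- The configuration of all particles given by a configuration `a` of the particles in `A` and
a configuration `b` of the other ones. -/
def glue (A : Finset ι) (a : {i // i ∈ A} → Fin M) (b : {i // i ∉ A} → Fin M) : ι → Fin M :=
  fun i => if h : i ∈ A then a ⟨i, h⟩ else b ⟨i, h⟩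

/-- The reduced density matrix on `A` of the normalized state `ψ / ‖ψ‖`: the partial trace of
`|ψ⟩⟨ψ| / ‖ψ‖ ^ 2` over the particles outside `A`. -/
def reducedDensity (A : Finset ι) (ψ : EuclideanSpace ℂ (ι → Fin M)) :
    Matrix ({i // i ∈ A} → Fin M) ({i // i ∈ A} → Fin M) ℂ :=
  fun a a' =>
    (∑ b : {i // i ∉ A} → Fin M, ψ (glue A a b) * star (ψ (glue A a' b))) / ((‖ψ‖ ^ 2 : ℝ) : ℂ)

theorem reducedDensity_isHermitian (A : Finset ι) (ψ : EuclideanSpace ℂ (ι → Fin M)) :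
    (reducedDensity A ψ).IsHermitian := by
  ext a a'
  simp only [Matrix.conjTranspose_apply, reducedDensity, star_div₀, star_sum, star_mul',
    RCLike.star_def, Complex.conj_ofReal, Complex.conj_conj]
  congr 1
  exact Finset.sum_congr rfl fun b _ => mul_comm _ _

/-- The entanglement entropy of `ψ` with respect to the partition into `A` and its complement:
the von Neumann entropy `-Tr (ρ log ρ)` of the reduced density matrix. -/
def entanglementEntropy (A : Finset ι) (ψ : EuclideanSpace ℂ (ι → Fin M)) : ℝ :=
  ∑ j, Real.negMulLog ((reducedDensity_isHermitian A ψ).eigenvalues j)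

end Entanglement

/-- The maximal entanglement entropy, with respect to `A` and its complement, of the state of the
network, over all parameters that give a non-zero state. -/
def maxEE (d H K L : ℕ) (r : ℕ → ℕ) (A : Finset (Site d H)) : ℝ :=
  sSup {S : ℝ | ∃ θ : Params d H K L r, state θ ≠ 0 ∧ S = entanglementEntropy A (state θ)}

/-- The cube with side length `α` and lowest corner `a`: an interval of `α` sites for `d = 1` and
an `α × α` square for `d = 2`, if it fits into the lattice. -/
def block {d H : ℕ} (a : Fin d → ℕ) (α : ℕ) : Finset (Site d H) :=
  {p | ∀ i, a i ≤ (p i : ℕ) ∧ (p i : ℕ) < a i + α}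

end OverlapCAC

end

/-!
The network can compute parities. With two channels, let channel `0` carry the constant `1` and
channel `1` a sign: the entrywise product over a window multiplies the signs at the positions whose
weight matrix is the identity (the taps) and ignores those whose weight matrix copies the constant.
A layer with taps at the centre `p` and at `p - u e`, for a unit vector `e`, therefore replaces
the sign at `p` by the product of the signs at `p` and `p - u e`, and after `L` layers with steps
`u 0, …, u (L - 1) ≤ K / 2` the sign at `p` is a parity `σ p` of spins on the segment from `p` back
to `p - D e`, `D = ∑ u`, in which both end points occur exactly once. Positions outside the lattice
contribute no factor, so they do no harm.

Spins have `r 0 ≥ 2` levels; the first layer annihilates every level but two.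

Pooling with `1 + σ p` at the sites `p` of a set `P`, and with `1` elsewhere, makes the amplitude
`∏ p ∈ P, (1 + σ p) = ∑ T ⊆ P, ∏ p ∈ T, σ p`. Each `σ p` is a character of the group of sign fields,
so it factors over `A` and its complement, and the sum over `T` is a Schmidt decomposition as soon
as the characters `∏ p ∈ T, σ p` are orthogonal on both sides of the bipartition. This holds when
one side contains the sites of `P` and the other one the far ends of their segments: near ends, and
far ends, are triangular with respect to the coordinate along `e` (`charVector_gram`,
`parity_gram_near`, `parity_gram_far`). All `2 ^ #P` Schmidt weights are equal, so the entropy is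
`#P * log 2` (`entanglementEntropy_of_orthogonal`, `card_mul_log_two_le_maxEE`).

For a block with side length `α` take for `P` a slab of thickness `D` along a face, with
`#P = D * α ^ (d - 1)`. The only constraints are `D ≤ α`, `D ≤ L * (K / 2)` and that there are `D`
rows of sites between that face, or the opposite one, and the edge of the lattice; as the block is
at most half of the lattice, the last one costs only a constant factor (`exists_gap`).
-/

noncomputable section

namespace OverlapCAC

/-! ### Entanglement entropy -/

section EntropyFacts

variable {ι : Type} [Fintype ι] [DecidableEq ι] {M : ℕ}

theorem sum_glue {R : Type*} [AddCommMonoid R] (A : Finset ι) (f : (ι → Fin M) → R) :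
    ∑ a, ∑ b, f (glue A a b) = ∑ s, f s := by
  rw [← Fintype.sum_prod_type' (f := fun a b => f (glue A a b))]
  exact (Equiv.piEquivPiSubtypeProd (fun i => i ∈ A) (fun _ => Fin M)).symm.sum_comp f

theorem trace_reducedDensity (A : Finset ι) {ψ : EuclideanSpace ℂ (ι → Fin M)} (hψ : ψ ≠ 0) :
    (reducedDensity A ψ).trace = 1 := by
  have hn : ((‖ψ‖ ^ 2 : ℝ) : ℂ) ≠ 0 := by
    exact_mod_cast pow_ne_zero 2 (norm_ne_zero_iff.2 hψ)
  simp only [Matrix.trace, Matrix.diag_apply, reducedDensity]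
  rw [← Finset.sum_div, sum_glue A (fun s => ψ s * star (ψ s)), div_eq_one_iff_eq hn,
    EuclideanSpace.norm_sq_eq]
  push_cast
  exact Finset.sum_congr rfl fun s _ => Complex.mul_conj' (ψ s)

open scoped ComplexOrder in
theorem reducedDensity_posSemidef (A : Finset ι) (ψ : EuclideanSpace ℂ (ι → Fin M)) :
    (reducedDensity A ψ).PosSemidef := by
  have h : reducedDensity A ψ = ((‖ψ‖ ^ 2 : ℝ)⁻¹ : ℝ) •
      ((Matrix.of fun a b => ψ (glue A a b)) * (Matrix.of fun a b => ψ (glue A a b))ᴴ) := by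
    ext a a'
    simp [reducedDensity, Matrix.mul_apply, div_eq_inv_mul]
  rw [h]
  exact (Matrix.posSemidef_self_mul_conjTranspose _).smul (by positivity)

open scoped ComplexOrder in
theorem entanglementEntropy_le_card (A : Finset ι) (ψ : EuclideanSpace ℂ (ι → Fin M)) :
    entanglementEntropy A ψ ≤ Fintype.card ({i // i ∈ A} → Fin M) := by
  have h : ∀ j, Real.negMulLog ((reducedDensity_isHermitian A ψ).eigenvalues j) ≤ 1 := fun j => by
    have h0 := (reducedDensity_posSemidef A ψ).eigenvalues_nonneg j
    have := Real.negMulLog_le_one_sub_self h0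
    linarith
  exact (Finset.sum_le_sum fun j _ => h j).trans (by simp)

/-- A state with an explicit Schmidt decomposition into `card τ` terms of equal weight is maximally
entangled: its reduced density matrix is `1 / card τ` times a projection of rank `card τ`. -/
theorem entanglementEntropy_of_orthogonal {τ : Type*} [Fintype τ] [DecidableEq τ] (A : Finset ι)
    {ψ : EuclideanSpace ℂ (ι → Fin M)} (hψ : ψ ≠ 0)
    (U : Matrix τ ({i // i ∈ A} → Fin M) ℝ) (V : Matrix τ ({i // i ∉ A} → Fin M) ℝ) (x y : ℝ)
    (hU : U * Uᵀ = x • 1) (hV : V * Vᵀ = y • 1)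
    (h : ∀ a b, ψ (glue A a b) = ((Uᵀ * V) a b : ℝ)) :
    entanglementEntropy A ψ = Real.log (Fintype.card τ) := by
  set R := ((‖ψ‖ ^ 2)⁻¹ * y) • (Uᵀ * U) with hR
  have hρ : reducedDensity A ψ = R.map (algebraMap ℝ ℂ) := by
    have h1 : Uᵀ * V * (Uᵀ * V)ᵀ = y • (Uᵀ * U) := by
      rw [Matrix.transpose_mul, Matrix.transpose_transpose, Matrix.mul_assoc, ← Matrix.mul_assoc V,
        hV]
      simp
    ext a a'
    have h2 := congrFun (congrFun h1 a) a'
    rw [Matrix.mul_apply] at h2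
    simp only [reducedDensity, h, RCLike.star_def, Complex.conj_ofReal, Matrix.map_apply, hR,
      mul_smul, Matrix.smul_apply, Complex.coe_algebraMap]
    rw [← Matrix.smul_apply y, ← h2, div_eq_inv_mul]
    simp
  have hsq : R * R = ((‖ψ‖ ^ 2)⁻¹ * y * x) • R := by
    have : Uᵀ * U * (Uᵀ * U) = x • (Uᵀ * U) := by
      rw [Matrix.mul_assoc, ← Matrix.mul_assoc U, hU]
      simp
    simp only [hR, Matrix.smul_mul, Matrix.mul_smul, this, smul_smul]
    congr 1
    ring
  have htr : (‖ψ‖ ^ 2)⁻¹ * y * x * Fintype.card τ = 1 := by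
    have h1 : R.trace = 1 := by
      have := trace_reducedDensity A hψ
      rw [hρ, ← AddMonoidHom.map_trace] at this
      exact Complex.ofReal_injective this
    rw [hR, Matrix.trace_smul, Matrix.trace_mul_comm, hU] at h1
    simpa [mul_assoc] using h1
  set w := (‖ψ‖ ^ 2)⁻¹ * y * x with hw
  have hn : (Fintype.card τ : ℝ) ≠ 0 := right_ne_zero_of_mul_eq_one htr
  have hw' : w = (Fintype.card τ : ℝ)⁻¹ := eq_inv_of_mul_eq_one_left htr
  have hev : ∀ j, Real.negMulLog ((reducedDensity_isHermitian A ψ).eigenvalues j)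
      = (reducedDensity_isHermitian A ψ).eigenvalues j * Real.log (Fintype.card τ) := by
    intro j
    set hH := reducedDensity_isHermitian A ψ
    set ev := hH.eigenvalues j with hev
    have hv := hH.mulVec_eigenvectorBasis j
    have hne : (hH.eigenvectorBasis j : EuclideanSpace ℂ _).ofLp ≠ 0 := fun h0 =>
      hH.eigenvectorBasis.toBasis.ne_zero j (by ext i; simpa using congrFun h0 i)
    have hsq' : reducedDensity A ψ * reducedDensity A ψ = w • reducedDensity A ψ := by
      rw [hρ, ← Matrix.map_mul, hsq]
      ext a a'
      simp
    have h1 : ev * ev = w * ev := by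
      have h2 := congrArg (· *ᵥ (hH.eigenvectorBasis j : EuclideanSpace ℂ _).ofLp) hsq'
      simp only [← Matrix.mulVec_mulVec, Matrix.smul_mulVec, hv, Matrix.mulVec_smul,
        smul_smul] at h2
      exact smul_left_injective ℝ hne h2
    rcases eq_or_ne ev 0 with h0 | h0
    · simp [h0]
    · rw [mul_right_cancel₀ h0 h1, hw', Real.negMulLog, Real.log_inv]
      ring
  have hsum : ∑ j, (reducedDensity_isHermitian A ψ).eigenvalues j = 1 := by
    have := (reducedDensity_isHermitian A ψ).trace_eq_sum_eigenvalues
    rw [trace_reducedDensity A hψ] at this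
    exact Complex.ofReal_injective (by simpa using this.symm)
  rw [entanglementEntropy, Finset.sum_congr rfl fun j _ => hev j, ← Finset.sum_mul, hsum, one_mul]

end EntropyFacts

theorem le_maxEE {d H K L : ℕ} {r : ℕ → ℕ} (A : Finset (Site d H)) (θ : Params d H K L r)
    (hθ : state θ ≠ 0) : entanglementEntropy A (state θ) ≤ maxEE d H K L r A :=
  le_csSup ⟨_, by rintro _ ⟨θ', -, rfl⟩; exact entanglementEntropy_le_card A _⟩ ⟨θ, hθ, rfl⟩

/-! ### Orthogonality of sign characters -/

section Characters

variable {ι κ : Type} {M : ℕ}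

/-- The sign field that is `-1` at `q` and `1` elsewhere. -/
def flipAt [DecidableEq ι] (q : ι) : ι → ℝ := fun p => if p = q then -1 else 1

/-- The sign of a spin: `1` and `-1` on the first two levels, and `0` on the other ones, so that
its square is the indicator function of the first two levels. -/
def levelSign (j : Fin M) : ℝ := if (j : ℕ) = 0 then 1 else if (j : ℕ) = 1 then -1 else 0

/-- The signs of the spins on part of the lattice, extended by `1` to the other sites. -/
def signField (s : ι → Prop) [DecidablePred s] (a : {i // s i} → Fin M) : ι → ℝ :=
  fun i => if h : s i then levelSign (a ⟨i, h⟩) else 1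

/-- The product of the characters in `T`, as a function of the spins on part of the lattice, cut
off to the first two levels of each spin. -/
def charVector (s : ι → Prop) [DecidablePred s] [Fintype {i // s i}] (χ : κ → (ι → ℝ) →* ℝ)
    (T : Finset κ) (a : {i // s i} → Fin M) : ℝ :=
  (∏ i, levelSign (a i)) ^ 2 * ∏ k ∈ T, χ k (signField s a)

theorem levelSign_sq_of_ne_zero {j : Fin M} (h : levelSign j ≠ 0) : levelSign j ^ 2 = 1 := by
  unfold levelSign at *
  split_ifs at * <;> simp_all

/-- The permutation of the levels that exchanges the first two. -/
def levelSwap (hM : 2 ≤ M) : Equiv.Perm (Fin M) := Equiv.swap ⟨0, by omega⟩ ⟨1, by omega⟩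

theorem levelSign_levelSwap (hM : 2 ≤ M) (j : Fin M) :
    levelSign (levelSwap hM j) = -levelSign j := by
  unfold levelSwap
  rcases eq_or_ne j ⟨0, by omega⟩ with rfl | h0
  · simp [levelSign]
  rcases eq_or_ne j ⟨1, by omega⟩ with rfl | h1
  · simp [levelSign]
  rw [Equiv.swap_apply_of_ne_of_ne h0 h1]
  simp_all [levelSign, Fin.ext_iff]

variable (s : ι → Prop) [DecidablePred s] [Fintype {i // s i}] (χ : κ → (ι → ℝ) →* ℝ)

theorem charVector_mul_self (T : Finset κ) (a : {i // s i} → Fin M) :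
    charVector s χ T a * charVector s χ T a = (∏ i, levelSign (a i)) ^ 2 := by
  unfold charVector
  by_cases h : ∏ i, levelSign (a i) = 0
  · simp [h]
  have hne : ∀ i, levelSign (a i) ≠ 0 := fun i => Finset.prod_ne_zero_iff.1 h i (Finset.mem_univ i)
  have h1 : (∏ i, levelSign (a i)) ^ 2 = 1 := by
    rw [← Finset.prod_pow]
    exact Finset.prod_eq_one fun i _ => levelSign_sq_of_ne_zero (hne i)
  have h2 : signField s a * signField s a = 1 := by
    ext i
    simp only [Pi.mul_apply, signField, Pi.one_apply]
    split_ifs with hi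
    · rw [← sq, levelSign_sq_of_ne_zero (hne _)]
    · norm_num
  rw [h1, one_mul, ← Finset.prod_mul_distrib]
  exact Finset.prod_eq_one fun k _ => by rw [← map_mul, h2, map_one]

/-- Orthogonality: exchanging the two levels of the spin at `q` is an involution that reverses the
sign of the summand. -/
theorem sum_charVector_mul_eq_zero [DecidableEq ι] (hM : 2 ≤ M) (T T' : Finset κ) (q : ι) (hq : s q)
    (h : (∏ k ∈ T, χ k (flipAt q)) * ∏ k ∈ T', χ k (flipAt q) = -1) :
    ∑ a : {i // s i} → Fin M, charVector s χ T a * charVector s χ T' a = 0 := by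
  let e : Equiv.Perm ({i // s i} → Fin M) :=
    Equiv.piCongrRight fun i => if (i : ι) = q then levelSwap hM else 1
  have hsign : ∀ a, signField s (e a) = signField s a * flipAt q := by
    intro a
    ext i
    by_cases hi : s i
    · by_cases hiq : i = q
      · simp [signField, flipAt, e, hiq, hq, levelSign_levelSwap]
      · simp [signField, flipAt, e, hi, hiq]
    · have : i ≠ q := fun h => hi (h ▸ hq)
      simp [signField, flipAt, hi, this]
  have hprod : ∀ a, (∏ i, levelSign (e a i)) ^ 2 = (∏ i, levelSign (a i)) ^ 2 := by
    intro a
    rw [← Finset.prod_pow, ← Finset.prod_pow]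
    refine Finset.prod_congr rfl fun i _ => ?_
    by_cases hiq : (i : ι) = q
    · simp [e, hiq, levelSign_levelSwap]
    · simp [e, hiq]
  have hneg : ∀ a, charVector s χ T (e a) * charVector s χ T' (e a) =
      -(charVector s χ T a * charVector s χ T' a) := by
    intro a
    simp only [charVector, hprod, hsign, map_mul, Finset.prod_mul_distrib]
    linear_combination ((∏ i, levelSign (a i)) ^ 2 * ∏ k ∈ T, χ k (signField s a)) *
      ((∏ i, levelSign (a i)) ^ 2 * ∏ k ∈ T', χ k (signField s a)) * h
  have h1 := Equiv.sum_comp e fun a => charVector s χ T a * charVector s χ T' a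
  simp only [hneg, Finset.sum_neg_distrib] at h1
  linarith

variable [DecidableEq ι] [DecidableEq κ]

/-- The characters are independent if they are triangular with respect to single spin flips: the
spin flip at `g k` changes `χ k`, and no other character of rank at most that of `k`. -/
theorem charVector_gram (hM : 2 ≤ M) (P : Finset κ) (rank : κ → ℤ) (g : κ → ι)
    (hg : ∀ k ∈ P, s (g k)) (hself : ∀ k ∈ P, χ k (flipAt (g k)) = -1)
    (hother : ∀ k ∈ P, ∀ k' ∈ P, k' ≠ k → rank k' ≤ rank k → χ k' (flipAt (g k)) = 1) :
    let U : Matrix P.powerset ({i // s i} → Fin M) ℝ := Matrix.of fun T a => charVector s χ T.1 a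
    U * Uᵀ = (∑ a : {i // s i} → Fin M, (∏ i, levelSign (a i)) ^ 2) • 1 := by
  intro U
  ext T T'
  rw [Matrix.mul_apply, Matrix.smul_apply, Matrix.one_apply]
  simp only [U, Matrix.of_apply, Matrix.transpose_apply]
  split_ifs with hTT
  · subst hTT
    simp only [charVector_mul_self, smul_eq_mul, mul_one]
  · rw [smul_zero]
    have hne : (symmDiff T.1 T'.1).Nonempty := by
      rw [Finset.nonempty_iff_ne_empty]
      intro h0
      exact hTT (Subtype.ext (symmDiff_eq_bot.1 h0))
    obtain ⟨k, hk, hmax⟩ := Finset.exists_max_image _ rank hne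
    have hsub : symmDiff T.1 T'.1 ⊆ P := fun x hx => by
      rcases Finset.mem_symmDiff.1 hx with h | h
      · exact Finset.mem_powerset.1 T.2 h.1
      · exact Finset.mem_powerset.1 T'.2 h.1
    refine sum_charVector_mul_eq_zero s χ hM _ _ (g k) (hg k (hsub hk)) ?_
    have hsq : ∀ k', χ k' (flipAt (g k)) * χ k' (flipAt (g k)) = 1 := fun k' => by
      rw [← map_mul]
      have : flipAt (g k) * flipAt (g k) = 1 := by
        ext i
        by_cases hi : i = g k <;> simp [flipAt, hi]
      rw [this, map_one]
    have hinter : (∏ k' ∈ T.1 ∩ T'.1, χ k' (flipAt (g k))) *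
        ∏ k' ∈ T.1 ∩ T'.1, χ k' (flipAt (g k)) = 1 := by
      rw [← Finset.prod_mul_distrib]
      exact Finset.prod_eq_one fun k' _ => hsq k'
    have hsymm : (∏ k' ∈ T.1 \ T'.1, χ k' (flipAt (g k))) *
        ∏ k' ∈ T'.1 \ T.1, χ k' (flipAt (g k)) = -1 := by
      rw [← Finset.prod_union (disjoint_sdiff_sdiff)]
      change ∏ k' ∈ symmDiff T.1 T'.1, _ = _
      rw [Finset.prod_eq_single_of_mem k hk, hself k (hsub hk)]
      exact fun k' hk' hne' => hother k (hsub hk) k' (hsub hk') hne' (hmax k' hk')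
    rw [← Finset.prod_inter_mul_prod_sdiff T.1 T'.1, ← Finset.prod_inter_mul_prod_sdiff T'.1 T.1,
      Finset.inter_comm T'.1 T.1]
    rw [mul_mul_mul_comm, hinter, hsymm, one_mul]

end Characters

/-! ### Propagation of parities along a line -/

section Parity

variable {d H : ℕ} (i₀ : Fin d)

/-- The sites `p` and `p - m e`, where `e` is the unit vector in direction `i₀`, as far as they lie
in the lattice. -/
def window (m : ℕ) (p : Site d H) : Finset (Site d H) :=
  {q | (∀ i, i ≠ i₀ → q i = p i) ∧ ((q i₀ : ℕ) = p i₀ ∨ (q i₀ : ℕ) + m = p i₀)}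

/-- The parity computed by layer `l` at the site `p`, as a character of the sign field on the
lattice: a layer with step `m` multiplies the signs in `window i₀ m p`. -/
def parity (u : ℕ → ℕ) : ℕ → Site d H → (Site d H → ℝ) →* ℝ
  | 0, p => Pi.evalMonoidHom _ p
  | l + 1, p => ∏ q ∈ window i₀ (u l) p, parity u l q

variable {i₀} {u : ℕ → ℕ}

theorem parity_succ (l : ℕ) (p : Site d H) (f : Site d H → ℝ) :
    parity i₀ u (l + 1) p f = ∏ q ∈ window i₀ (u l) p, parity i₀ u l q f := by
  rw [parity, MonoidHom.finsetProd_apply]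

theorem mem_window {m : ℕ} {p q : Site d H} : q ∈ window i₀ m p ↔
    (∀ i, i ≠ i₀ → q i = p i) ∧ ((q i₀ : ℕ) = p i₀ ∨ (q i₀ : ℕ) + m = p i₀) := by
  simp [window]

/-- The light cone: only the sites of the segment from `p` back to `p - (∑ u) e` matter. -/
theorem parity_flipAt_eq_one (l : ℕ) (p q : Site d H)
    (h : (∀ i, i ≠ i₀ → q i = p i) → (q i₀ : ℕ) ≤ p i₀ →
      (q i₀ : ℕ) + ∑ n ∈ Finset.range l, u n < p i₀) :
    parity i₀ u l p (flipAt q) = 1 := by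
  induction l generalizing p with
  | zero =>
    have : p ≠ q := by
      rintro rfl
      simpa using h (fun _ _ => rfl) le_rfl
    simp [parity, flipAt, this]
  | succ l ih =>
    rw [parity_succ]
    refine Finset.prod_eq_one fun q' hq' => ih q' fun h1 h2 => ?_
    rw [mem_window] at hq'
    have h3 := h (fun i hi => (h1 i hi).trans (hq'.1 i hi)) (by omega)
    rw [Finset.sum_range_succ] at h3
    omega

theorem parity_flipAt_self (l : ℕ) (p : Site d H) : parity i₀ u l p (flipAt p) = -1 := by
  induction l with
  | zero => simp [parity, flipAt]
  | succ l ih =>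
    rw [parity_succ, Finset.prod_eq_single_of_mem p (mem_window.2 ⟨fun _ _ => rfl, .inl rfl⟩), ih]
    intro q hq hne
    refine parity_flipAt_eq_one l q p fun h1 h2 => absurd ?_ hne
    rw [mem_window] at hq
    ext i
    by_cases hi : i = i₀
    · subst hi
      omega
    · rw [h1 i hi]

/-- The far end of the segment is reached along exactly one path. -/
theorem parity_flipAt_far (l : ℕ) (p q : Site d H) (h : ∀ i, i ≠ i₀ → q i = p i)
    (h0 : (q i₀ : ℕ) + ∑ n ∈ Finset.range l, u n = p i₀) :
    parity i₀ u l p (flipAt q) = -1 := by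
  induction l generalizing p with
  | zero =>
    have : p = q := by
      ext i
      by_cases hi : i = i₀
      · subst hi
        simpa using h0.symm
      · rw [h i hi]
    simp [parity, flipAt, this]
  | succ l ih =>
    rw [Finset.sum_range_succ] at h0
    have hlt : (q i₀ : ℕ) + ∑ n ∈ Finset.range l, u n < H := by
      have := (p i₀).2
      omega
    have hmem : Function.update p i₀ ⟨_, hlt⟩ ∈ window i₀ (u l) p := by
      rw [mem_window]
      refine ⟨fun i hi => by simp [hi], .inr ?_⟩
      simp only [Function.update_self]
      omega
    rw [parity_succ, Finset.prod_eq_single_of_mem _ hmem, ih]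
    · exact fun i hi => by simp [hi, h]
    · simp
    · intro q' hq' hne
      rw [mem_window] at hq'
      refine parity_flipAt_eq_one l q' q fun h1 h2 => ?_
      rcases hq'.2 with h3 | h3
      · by_contra h4
        refine hne (funext fun i => ?_)
        by_cases hi : i = i₀
        · subst hi
          simp only [Function.update_self, Fin.ext_iff]
          omega
        · simp [hi, hq'.1]
      · refine absurd (funext fun i => ?_) hne
        by_cases hi : i = i₀
        · subst hi
          simp only [Function.update_self, Fin.ext_iff]
          omega
        · simp [hi, hq'.1]

end Parity

/-! ### A network that computes parities -/

section Network

variable {d H K L : ℕ} {r : ℕ → ℕ} (i₀ : Fin d)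

/-- The kernel positions that look at the sites `p` and `p - m e`, seen from `p`; the centre of the
kernel is at `K / 2` in every coordinate. -/
def IsTap (m : ℕ) (k : Offset d K) : Prop :=
  (∀ i, i ≠ i₀ → (k i : ℕ) = K / 2) ∧ ((k i₀ : ℕ) = K / 2 ∨ (k i₀ : ℕ) + m = K / 2)

open Classical in
/-- The parameters of the parity network. From layer `1` on, channel `0` is constantly `1` and
channel `1` carries a parity, provided that all spins are in the first two levels; the taps pass on
the parity and all other kernel positions the constant. The first layer reads off the sign of a spin in place of the parity, and maps the
levels other than the first two to `0`. The pooling layer adds the two channels at the sites of `P`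
and takes the constant channel elsewhere. -/
def parityParams (u : ℕ → ℕ) (P : Finset (Site d H)) : Params d H K L r where
  conv l k := Matrix.of fun c j =>
    if (l : ℕ) = 0 then
      if (c : ℕ) = 1 ∧ IsTap i₀ (u l) k then levelSign j else levelSign j ^ 2
    else
      if (c : ℕ) = 1 ∧ IsTap i₀ (u l) k then if (j : ℕ) = 1 then 1 else 0
      else if (j : ℕ) = 0 then 1 else 0
  pool p c := if (c : ℕ) = 0 then 1 else if (c : ℕ) = 1 ∧ p ∈ P then 1 else 0

variable {i₀} {u : ℕ → ℕ} {P : Finset (Site d H)}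

open Classical in
theorem prod_tap_eq_prod_window (hK : 2 ≤ K) {m : ℕ} (hm : m ≤ K / 2) (F : Site d H → ℝ)
    (p : Site d H) :
    ∏ k : Offset d K, ∏ q : Site d H with (∀ i, (q i : ℕ) + K / 2 = (p i : ℕ) + (k i : ℕ)),
      (if IsTap i₀ m k then F q else 1) = ∏ q ∈ window i₀ m p, F q := by
  simp only [Finset.prod_filter, window]
  rw [Finset.prod_comm]
  refine Finset.prod_congr rfl fun q _ => ?_
  split_ifs with hq
  · have hlt : ∀ i, (q i : ℕ) + K / 2 - p i < K := fun i => by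
      by_cases hi : i = i₀
      · subst hi
        omega
      · rw [hq.1 i hi]
        omega
    rw [Finset.prod_eq_single (fun i => ⟨(q i : ℕ) + K / 2 - p i, hlt i⟩), if_pos, if_pos]
    · refine ⟨fun i hi => ?_, ?_⟩
      · simp [hq.1 i hi]
      · simp only
        omega
    · intro i
      by_cases hi : i = i₀
      · subst hi
        simp only
        omega
      · simp [hq.1 i hi]
    · intro k _ hk
      refine if_neg fun h => hk (funext fun i => Fin.ext ?_)
      have := h i
      simp only
      omega
    · simp
  · refine Finset.prod_eq_one fun k _ => ?_
    split_ifs with h1 h2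
    · refine absurd ⟨fun i hi => ?_, ?_⟩ hq
      · have := h1 i
        have := h2.1 i hi
        exact Fin.ext (by omega)
      · have := h1 i₀
        have := h2.2
        omega
    · rfl
    · rfl

theorem sum_ite_val_eq {n a : ℕ} (ha : a < n) (f : Fin n → ℝ) :
    ∑ j : Fin n, (if (j : ℕ) = a then 1 else 0) * f j = f ⟨a, ha⟩ := by
  rw [Finset.sum_eq_single ⟨a, ha⟩]
  · simp
  · intro j _ hj
    rw [if_neg fun h => hj (Fin.ext h), zero_mul]
  · simp

open Classical in
theorem layerOut_succ_parityParams (hK : 2 ≤ K) {l : ℕ} (hl : l + 1 ≤ L) (hu : u l ≤ K / 2)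
    (x : FeatureMap d H (r 0)) (f : Site d H → ℝ) (c : Fin (r (l + 1)))
    (h : ∀ (k : Offset d K) (q : Site d H), ((parityParams (K := K) i₀ u P).conv ⟨l, hl⟩ k *ᵥ
        layerOut (parityParams (K := K) i₀ u P) x l (Nat.le_of_succ_le hl) q) c =
      if (c : ℕ) = 1 ∧ IsTap i₀ (u l) k then parity i₀ u l q f else 1) (p : Site d H) :
    layerOut (parityParams (K := K) i₀ u P) x (l + 1) hl p c =
      if (c : ℕ) = 1 then parity i₀ u (l + 1) p f else 1 := by
  simp only [layerOut, convLayer, h]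
  split_ifs with hc
  · rw [parity_succ, ← prod_tap_eq_prod_window hK hu (fun q => parity i₀ u l q f) p]
    refine Finset.prod_congr rfl fun k _ => Finset.prod_congr rfl fun q _ => ?_
    exact if_congr (and_iff_right hc) rfl rfl
  · exact Finset.prod_eq_one fun k _ => Finset.prod_eq_one fun q _ => if_neg fun h' => hc h'.1

/-- On configurations that use only the first two levels, channel `1` of a convolution layer is
the parity with steps `u`, and the other channels are constant. -/
theorem layerOut_parityParams (hK : 2 ≤ K) (hr : ∀ l ≤ L, 2 ≤ r l) (hu : ∀ l, u l ≤ K / 2)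
    {s : Site d H → Fin (r 0)} (hs : ∀ p, levelSign (s p) ≠ 0) (l : ℕ) (hl : l + 1 ≤ L)
    (p : Site d H) (c : Fin (r (l + 1))) :
    layerOut (parityParams (K := K) i₀ u P) (fun q => Pi.single (s q) 1) (l + 1) hl p c =
      if (c : ℕ) = 1 then parity i₀ u (l + 1) p (fun q => levelSign (s q)) else 1 := by
  induction l generalizing p with
  | zero =>
    refine layerOut_succ_parityParams hK hl (hu 0) _ _ c (fun k q => ?_) p
    simp only [layerOut, Matrix.mulVec_single_one, Matrix.col_apply, parityParams, parity,
      Matrix.of_apply, if_true, Pi.evalMonoidHom_apply]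
    split_ifs
    · rfl
    · exact levelSign_sq_of_ne_zero (hs q)
  | succ l ih =>
    refine layerOut_succ_parityParams hK hl (hu _) _ _ c (fun k q => ?_) p
    have h2 := hr (l + 1) (Nat.le_of_succ_le hl)
    rw [Matrix.mulVec, dotProduct,
      Finset.sum_congr rfl fun c' _ => by rw [ih (Nat.le_of_succ_le hl) q c']]
    simp only [parityParams, Matrix.of_apply, Nat.add_eq_zero_iff, one_ne_zero, and_false, if_false]
    split_ifs with hc
    · rw [sum_ite_val_eq (a := 1) (by omega)]
      simp
    · rw [sum_ite_val_eq (a := 0) (by omega)]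
      simp

/-- The kernel position `K / 2` looks at the site itself. -/
theorem convLayer_eq_zero {m n : ℕ} (hK : 2 ≤ K) {W : Offset d K → Matrix (Fin n) (Fin m) ℝ}
    {x : FeatureMap d H m} {q : Site d H} (h : W (fun _ => ⟨K / 2, by omega⟩) *ᵥ x q = 0) :
    convLayer W x q = 0 := by
  ext c
  refine Finset.prod_eq_zero (Finset.mem_univ fun _ => (⟨K / 2, by omega⟩ : Fin K))
    (Finset.prod_eq_zero (i := q) (by simp) ?_)
  rw [h]
  rfl

/-- A spin outside the first two levels annihilates the features at its own site. -/
theorem layerOut_parityParams_eq_zero (hK : 2 ≤ K) {s : Site d H → Fin (r 0)} {q : Site d H}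
    (hq : levelSign (s q) = 0) (l : ℕ) (hl : l + 1 ≤ L) :
    layerOut (parityParams (K := K) i₀ u P) (fun q => Pi.single (s q) 1) (l + 1) hl q = 0 := by
  induction l with
  | zero =>
    refine convLayer_eq_zero hK ?_
    ext c
    simp [layerOut, parityParams, hq]
  | succ l ih =>
    refine convLayer_eq_zero hK ?_
    rw [ih, Matrix.mulVec_zero]

theorem output_parityParams (hK : 2 ≤ K) (hL : 1 ≤ L) (hr : ∀ l ≤ L, 2 ≤ r l)
    (hu : ∀ l, u l ≤ K / 2) (s : Site d H → Fin (r 0)) :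
    output (parityParams (K := K) (L := L) i₀ u P) (fun q => Pi.single (s q) 1) =
      (∏ p, levelSign (s p)) ^ 2 *
        ∏ p ∈ P, (1 + parity i₀ u L p (fun q => levelSign (s q))) := by
  obtain ⟨l, rfl⟩ : ∃ l, L = l + 1 := ⟨L - 1, by omega⟩
  unfold output
  by_cases hs : ∀ p, levelSign (s p) ≠ 0
  · have h1 : (∏ p, levelSign (s p)) ^ 2 = 1 := by
      rw [← Finset.prod_pow]
      exact Finset.prod_eq_one fun p _ => levelSign_sq_of_ne_zero (hs p)
    have h2 := hr (l + 1) le_rfl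
    have hpool : ∀ p, (parityParams (K := K) i₀ u P).pool p ⬝ᵥ
        layerOut (parityParams (K := K) i₀ u P) (fun q => Pi.single (s q) 1) (l + 1) le_rfl p =
          if p ∈ P then 1 + parity i₀ u (l + 1) p (fun q => levelSign (s q)) else 1 := by
      intro p
      rw [dotProduct, Finset.sum_congr rfl fun c _ => by rw [layerOut_parityParams hK hr hu hs],
        ← Finset.sum_subset (Finset.subset_univ {⟨0, by omega⟩, ⟨1, by omega⟩}),
        Finset.sum_pair (by simp)]
      · by_cases hp : p ∈ P <;> simp [parityParams, hp]
      · intro c _ hc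
        simp only [Finset.mem_insert, Finset.mem_singleton, not_or, Fin.ext_iff] at hc
        simp [parityParams, hc.1, hc.2]
    simp only [h1, one_mul, hpool, Finset.prod_ite_mem, Finset.univ_inter]
  · push Not at hs
    obtain ⟨q, hq⟩ := hs
    have h0 : ∏ p, levelSign (s p) = 0 := Finset.prod_eq_zero (Finset.mem_univ q) hq
    rw [h0, Finset.prod_eq_zero (Finset.mem_univ q)
      (by rw [layerOut_parityParams_eq_zero hK hq, dotProduct_zero])]
    simp

end Network

/-! ### The entropy of the parity network -/

section ParityEntropy

variable {d H K L : ℕ} {r : ℕ → ℕ} {i₀ : Fin d} {u : ℕ → ℕ} {P A : Finset (Site d H)}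

theorem site_ext {p q : Site d H} (h : ∀ i, i ≠ i₀ → q i = p i) (h0 : (q i₀ : ℕ) = p i₀) :
    q = p := by
  ext i
  by_cases hi : i = i₀
  · rw [hi, h0]
  · rw [h i hi]

theorem state_glue_parityParams (hK : 2 ≤ K) (hL : 1 ≤ L) (hr : ∀ l ≤ L, 2 ≤ r l)
    (hu : ∀ l, u l ≤ K / 2) (a : {p // p ∈ A} → Fin (r 0)) (b : {p // p ∉ A} → Fin (r 0)) :
    state (parityParams (K := K) (L := L) i₀ u P) (glue A a b) =
      ((∑ T ∈ P.powerset, charVector (· ∈ A) (parity i₀ u L) T a *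
        charVector (· ∉ A) (parity i₀ u L) T b : ℝ) : ℂ) := by
  have hf : (fun q => levelSign (glue A a b q)) =
      signField (· ∈ A) a * signField (· ∉ A) b := by
    ext q
    by_cases hq : q ∈ A <;> simp [glue, signField, hq]
  have hp : ∏ q, levelSign (glue A a b q) =
      (∏ q, levelSign (a q)) * ∏ q, levelSign (b q) := by
    rw [← Fintype.prod_subtype_mul_prod_subtype (· ∈ A)]
    congr 1
    · exact Finset.prod_congr (by ext; simp) fun q _ => by simp [glue, q.2]
    · exact Finset.prod_congr (by ext; simp) fun q _ => by simp [glue, q.2]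
  simp only [state, output_parityParams hK hL hr hu, hp]
  simp only [hf, Finset.prod_one_add, map_mul]
  congr 1
  rw [Finset.mul_sum]
  refine Finset.sum_congr rfl fun T _ => ?_
  simp only [charVector, Finset.prod_mul_distrib]
  ring

/-- Independence of the parities on a set that contains the near ends of their segments. -/
theorem parity_gram_near {M : ℕ} (hM : 2 ≤ M) (s : Site d H → Prop) [DecidablePred s]
    [Fintype {p // s p}]
    (hs : ∀ p ∈ P, s p) :
    let U : Matrix P.powerset ({p // s p} → Fin M) ℝ :=
      Matrix.of fun T a => charVector s (parity i₀ u L) T.1 a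
    U * Uᵀ = (∑ a : {p // s p} → Fin M, (∏ p, levelSign (a p)) ^ 2) • 1 := by
  refine charVector_gram s _ hM P (fun p => (p i₀ : ℕ)) id hs
    (fun p _ => parity_flipAt_self L p) fun p _ p' _ hne hle => ?_
  refine parity_flipAt_eq_one L p' p fun h1 h2 => absurd ?_ hne
  exact (site_ext h1 (le_antisymm h2 (by simpa using hle))).symm

/-- Independence of the parities on a set that contains the far ends of their segments. -/
theorem parity_gram_far {M : ℕ} (hM : 2 ≤ M) (s : Site d H → Prop) [DecidablePred s]
    [Fintype {p // s p}]
    (hs : ∀ p ∈ P, ∃ q : Site d H, s q ∧ (∀ i, i ≠ i₀ → q i = p i) ∧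
      (q i₀ : ℕ) + ∑ n ∈ Finset.range L, u n = p i₀) :
    let U : Matrix P.powerset ({p // s p} → Fin M) ℝ :=
      Matrix.of fun T a => charVector s (parity i₀ u L) T.1 a
    U * Uᵀ = (∑ a : {p // s p} → Fin M, (∏ p, levelSign (a p)) ^ 2) • 1 := by
  have hs' : ∀ p : Site d H, ∃ q : Site d H, p ∈ P → s q ∧ (∀ i, i ≠ i₀ → q i = p i) ∧
      (q i₀ : ℕ) + ∑ n ∈ Finset.range L, u n = p i₀ := fun p => by
    by_cases hp : p ∈ P
    · obtain ⟨q, hq⟩ := hs p hp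
      exact ⟨q, fun _ => hq⟩
    · exact ⟨p, fun h => absurd h hp⟩
  choose g hg using hs'
  refine charVector_gram s _ hM P (fun p => -(p i₀ : ℕ)) g (fun p hp => (hg p hp).1)
    (fun p hp => parity_flipAt_far L p _ (hg p hp).2.1 (hg p hp).2.2) fun p hp p' _ hne hle => ?_
  obtain ⟨-, h1, h2⟩ := hg p hp
  refine parity_flipAt_eq_one L p' _ fun h3 _ => ?_
  have hle' : (p i₀ : ℕ) ≤ p' i₀ := by simpa using hle
  rcases hle'.lt_or_eq with h4 | h4
  · omega
  · exact absurd (site_ext (i₀ := i₀) (fun i hi => (h3 i hi).symm.trans (h1 i hi)) h4.symm) hne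

/-- If the bipartition separates the two ends of the segment of every parity check, the checks are
independent on both sides, and each contributes one bit of entanglement. -/
theorem card_mul_log_two_le_maxEE (hK : 2 ≤ K) (hL : 1 ≤ L) (hr : ∀ l ≤ L, 2 ≤ r l)
    (hu : ∀ l, u l ≤ K / 2)
    (hfar : ∀ p ∈ P, ∃ q : Site d H, (∀ i, i ≠ i₀ → q i = p i) ∧
      (q i₀ : ℕ) + ∑ n ∈ Finset.range L, u n = p i₀ ∧ (q ∈ A ↔ p ∉ A))
    (hnear : (∀ p ∈ P, p ∈ A) ∨ ∀ p ∈ P, p ∉ A) :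
    P.card * Real.log 2 ≤ maxEE d H K L r A := by
  set θ : Params d H K L r := parityParams i₀ u P with hθ
  have hM : 2 ≤ r 0 := hr 0 (Nat.zero_le L)
  have h0 : state θ ≠ 0 := by
    intro h
    have h1 := congrArg (fun ψ : EuclideanSpace ℂ (Site d H → Fin (r 0)) =>
      ψ fun _ => ⟨0, by omega⟩) h
    have h2 : (fun _ : Site d H => (1 : ℝ)) = 1 := rfl
    simp [state, hθ, output_parityParams hK hL hr hu, levelSign, h2] at h1
  have hS : entanglementEntropy A (state θ) = Real.log (Fintype.card P.powerset) := by
    have hUV : ∃ x y : ℝ,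
        (Matrix.of fun (T : P.powerset) (a : {p // p ∈ A} → Fin (r 0)) =>
            charVector (· ∈ A) (parity i₀ u L) T.1 a) *
          (Matrix.of fun (T : P.powerset) (a : {p // p ∈ A} → Fin (r 0)) =>
            charVector (· ∈ A) (parity i₀ u L) T.1 a)ᵀ = x • 1 ∧
        (Matrix.of fun (T : P.powerset) (b : {p // p ∉ A} → Fin (r 0)) =>
            charVector (· ∉ A) (parity i₀ u L) T.1 b) *
          (Matrix.of fun (T : P.powerset) (b : {p // p ∉ A} → Fin (r 0)) =>
            charVector (· ∉ A) (parity i₀ u L) T.1 b)ᵀ = y • 1 := by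
      rcases hnear with hA | hB
      · refine ⟨_, _, parity_gram_near hM (· ∈ A) hA, parity_gram_far hM (· ∉ A) fun p hp => ?_⟩
        obtain ⟨q, h1, h2, h3⟩ := hfar p hp
        exact ⟨q, fun h => h3.1 h (hA p hp), h1, h2⟩
      · refine ⟨_, _, parity_gram_far hM (· ∈ A) fun p hp => ?_, parity_gram_near hM (· ∉ A) hB⟩
        obtain ⟨q, h1, h2, h3⟩ := hfar p hp
        exact ⟨q, h3.2 (hB p hp), h1, h2⟩
    obtain ⟨x, y, hU, hV⟩ := hUV
    refine entanglementEntropy_of_orthogonal A h0 _ _ x y hU hV fun a b => ?_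
    rw [hθ, state_glue_parityParams hK hL hr hu, Matrix.mul_apply]
    exact congrArg _ (Finset.sum_coe_sort P.powerset _).symm
  have hle := le_maxEE A θ h0
  rw [hS, Fintype.card_coe, Finset.card_powerset] at hle
  push_cast at hle
  rwa [Real.log_pow] at hle

end ParityEntropy

/-! ### Blocks in the lattice -/

section Geometry

/-- The box with lowest corner `lo` and side lengths `len`. -/
def box {d H : ℕ} (lo len : Fin d → ℕ) : Finset (Site d H) :=
  {p | ∀ i, lo i ≤ (p i : ℕ) ∧ (p i : ℕ) < lo i + len i}

theorem mem_box {d H : ℕ} {lo len : Fin d → ℕ} {p : Site d H} :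
    p ∈ box lo len ↔ ∀ i, lo i ≤ (p i : ℕ) ∧ (p i : ℕ) < lo i + len i := by
  simp [box]

theorem card_box {d H : ℕ} {lo len : Fin d → ℕ} (h : ∀ i, lo i + len i ≤ H) :
    (box lo len : Finset (Site d H)).card = ∏ i, len i := by
  have h1 : (box lo len : Finset (Site d H)) = Fintype.piFinset fun i =>
      ({x : Fin H | lo i ≤ (x : ℕ) ∧ (x : ℕ) < lo i + len i} : Finset (Fin H)) := by
    ext p
    simp [mem_box]
  rw [h1, Fintype.card_piFinset]
  refine Finset.prod_congr rfl fun i _ => ?_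
  rw [← Finset.card_map Fin.valEmbedding]
  have h2 : ({x : Fin H | lo i ≤ (x : ℕ) ∧ (x : ℕ) < lo i + len i} : Finset (Fin H)).map
      Fin.valEmbedding = Finset.Ico (lo i) (lo i + len i) := by
    ext x
    simp only [Finset.mem_map, Finset.mem_filter, Finset.mem_univ, true_and, Finset.mem_Ico,
      Fin.valEmbedding_apply]
    refine ⟨?_, fun hx => ⟨⟨x, by have := h i; omega⟩, hx, rfl⟩⟩
    rintro ⟨y, hy, rfl⟩
    exact hy
  rw [h2, Nat.card_Ico]
  omega

/-- `L` steps of length at most `m` reach every distance up to `L * m`. -/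
theorem exists_sum_range_eq (m L D : ℕ) (h : D ≤ L * m) :
    ∃ u : ℕ → ℕ, (∀ l, u l ≤ m) ∧ ∑ n ∈ Finset.range L, u n = D := by
  refine ⟨fun l => min m (D - l * m), fun l => min_le_left _ _, ?_⟩
  have : ∀ n, ∑ l ∈ Finset.range n, min m (D - l * m) = min (n * m) D := by
    intro n
    induction n with
    | zero => simp
    | succ n ih =>
      rw [Finset.sum_range_succ, ih, Nat.succ_mul]
      omega
  rw [this, min_eq_right h]

/-- The checks are based at the slab of thickness `D` just inside the lower face of the block, or
just outside the upper face, so that stepping back by `D` crosses its boundary. -/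
theorem slab_mul_log_two_le_maxEE {d H K L α : ℕ} {r : ℕ → ℕ} {a : Fin d → ℕ} (i₀ : Fin d)
    (hK : 2 ≤ K) (hL : 1 ≤ L) (hr : ∀ l ≤ L, 2 ≤ r l) (ha : ∀ i, a i + α ≤ H) {D : ℕ}
    (hDα : D ≤ α) (hDL : D ≤ L * (K / 2)) (hD : D ≤ a i₀ ∨ a i₀ + α + D ≤ H) :
    ((D * α ^ (d - 1) : ℕ) : ℝ) * Real.log 2 ≤
      maxEE d H K L r (block a α : Finset (Site d H)) := by
  obtain ⟨u, hu, hsum⟩ := exists_sum_range_eq (K / 2) L D hDL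
  have hmemA : ∀ p : Site d H, p ∈ (block a α : Finset (Site d H)) ↔
      ∀ i, a i ≤ (p i : ℕ) ∧ (p i : ℕ) < a i + α := fun p => by simp [block]
  obtain ⟨β, hβ, hβD, hβH⟩ : ∃ β, (β = a i₀ ∨ β = a i₀ + α) ∧ D ≤ β ∧ β + D ≤ H := by
    have := ha i₀
    rcases hD with h | h
    · exact ⟨_, .inl rfl, h, by omega⟩
    · exact ⟨_, .inr rfl, by omega, h⟩
  have hmemP : ∀ p : Site d H,
      p ∈ (box (Function.update a i₀ β) (Function.update (fun _ => α) i₀ D) : Finset (Site d H)) →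
      (∀ i, i ≠ i₀ → a i ≤ (p i : ℕ) ∧ (p i : ℕ) < a i + α) ∧
        β ≤ (p i₀ : ℕ) ∧ (p i₀ : ℕ) < β + D := fun p hp => by
    rw [mem_box] at hp
    refine ⟨fun i hi => ?_, ?_⟩
    · simpa [hi] using hp i
    · simpa using hp i₀
  have hcard : (box (Function.update a i₀ β) (Function.update (fun _ => α) i₀ D) :
      Finset (Site d H)).card = D * α ^ (d - 1) := by
    rw [card_box, Finset.prod_update_of_mem (Finset.mem_univ i₀), Finset.prod_const,
      Finset.card_sdiff_of_subset (by simp)]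
    · simp
    · intro i
      by_cases hi : i = i₀
      · subst hi
        simpa using hβH
      · simpa [hi] using ha i
  rw [← hcard]
  refine card_mul_log_two_le_maxEE (i₀ := i₀) hK hL hr hu (fun p hp => ?_) ?_
  -- Stepping back by `D ≤ α` from the slab crosses the lower face if `β = a i₀`, and the upper
  -- face if `β = a i₀ + α`.
  · obtain ⟨h1, h2, h3⟩ := hmemP p hp
    have hlt : (p i₀ : ℕ) - D < H := by
      have := (p i₀).2
      omega
    refine ⟨Function.update p i₀ ⟨_, hlt⟩, fun i hi => by simp [hi], ?_, ?_⟩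
    · simp only [Function.update_self, hsum]
      omega
    · have hq : Function.update p i₀ ⟨_, hlt⟩ ∈ (block a α : Finset (Site d H)) ↔
          a i₀ ≤ (p i₀ : ℕ) - D ∧ (p i₀ : ℕ) - D < a i₀ + α := by
        rw [hmemA]
        refine ⟨fun h => by simpa using h i₀, fun h i => ?_⟩
        by_cases hi : i = i₀
        · subst hi
          simpa using h
        · simpa [hi] using h1 i hi
      have hp' : p ∈ (block a α : Finset (Site d H)) ↔
          a i₀ ≤ (p i₀ : ℕ) ∧ (p i₀ : ℕ) < a i₀ + α := by
        rw [hmemA]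
        refine ⟨fun h => h i₀, fun h i => ?_⟩
        by_cases hi : i = i₀
        · subst hi
          exact h
        · exact h1 i hi
      rw [hq, hp']
      omega
  · rcases hβ with rfl | rfl
    · left
      intro p hp
      obtain ⟨h1, h2, h3⟩ := hmemP p hp
      rw [hmemA]
      intro i
      by_cases hi : i = i₀
      · subst hi
        omega
      · exact h1 i hi
    · right
      intro p hp hpA
      obtain ⟨h1, h2, h3⟩ := hmemP p hp
      have := (hmemA p).1 hpA i₀
      omega

/-- If the block is at most half of the lattice, then on one side of it, in every direction, there
are at least `α / 5` free rows of sites. For `d = 2` this rests on `√2 ≥ 7 / 5`. -/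
theorem exists_gap {d H α : ℕ} {a : Fin d → ℕ} (hd : d = 1 ∨ d = 2) (ha : ∀ i, a i + α ≤ H)
    (hcard : (block a α : Finset (Site d H)).card ≤ ((block a α)ᶜ : Finset (Site d H)).card)
    (i₀ : Fin d) : ∃ g, α ≤ 5 * g ∧ (g ≤ a i₀ ∨ a i₀ + α + g ≤ H) := by
  have h1 : (block a α : Finset (Site d H)).card = α ^ d := by
    have : (block a α : Finset (Site d H)) = box a fun _ => α := rfl
    rw [this, card_box ha]
    simp
  have h2 : 2 * α ^ d ≤ H ^ d := by
    rw [Finset.card_compl, h1] at hcard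
    simp only [Fintype.card_pi, Fintype.card_fin, Finset.prod_const, Finset.card_univ] at hcard
    have : α ^ d ≤ H ^ d := Nat.pow_le_pow_left (by have := ha i₀; omega) d
    omega
  have h3 : 7 * α ≤ 5 * H := by
    rcases hd with rfl | rfl
    · rw [pow_one, pow_one] at h2
      omega
    · by_contra h
      push Not at h
      nlinarith
  have := ha i₀
  rcases le_total (a i₀) (H - α - a i₀) with h | h
  · exact ⟨H - α - a i₀, by omega, .inr (by omega)⟩
  · exact ⟨a i₀, by omega, .inl le_rfl⟩

end Geometry

end OverlapCAC

end

theorem theorem1 :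
    ∃ c : ℝ, 0 < c ∧
      ∀ (d H K L α : ℕ) (r : ℕ → ℕ) (a : Fin d → ℕ),
        d = 1 ∨ d = 2 → 2 ≤ K → 1 ≤ L → 1 ≤ α →
        (∀ l, l ≤ L → 2 ≤ r l) →
        (∀ i, a i + α ≤ H) →
        (OverlapCAC.block a α : Finset (OverlapCAC.Site d H)).card ≤
          ((OverlapCAC.block a α)ᶜ : Finset (OverlapCAC.Site d H)).card →
        c * min ((α : ℝ) ^ d) ((L : ℝ) * (K : ℝ) * (α : ℝ) ^ (d - 1)) ≤
            OverlapCAC.maxEE d H K L r (OverlapCAC.block a α) ∧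
          (α < L * K →
            c * (α : ℝ) ^ d ≤ OverlapCAC.maxEE d H K L r (OverlapCAC.block a α)) := by
  have hlog : 0 < Real.log 2 := Real.log_pos one_lt_two
  refine ⟨Real.log 2 / 5, by positivity, fun d H K L α r a hd hK hL _ hr ha hcard => ?_⟩
  have hd0 : 0 < d := by omega
  obtain ⟨g, hg, hgap⟩ := OverlapCAC.exists_gap hd ha hcard ⟨0, hd0⟩
  have hmain := OverlapCAC.slab_mul_log_two_le_maxEE (r := r) ⟨0, hd0⟩ hK hL hr ha
    (D := min (min g α) (L * (K / 2))) (by omega) (by omega) (by omega)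
  have hpow : (α : ℝ) ^ d = α * (α : ℝ) ^ (d - 1) := by
    rw [← pow_succ', Nat.sub_add_cancel hd0]
  -- The factor `5` absorbs `α ≤ 5 * g` and `K ≤ 5 * (K / 2)`.
  have hD : min α (L * K) ≤ 5 * min (min g α) (L * (K / 2)) := by
    have : L * K ≤ L * (5 * (K / 2)) := Nat.mul_le_mul_left L (by omega)
    rw [Nat.mul_left_comm] at this
    omega
  have hD' : min (α : ℝ) (L * K) ≤ 5 * (min (min g α) (L * (K / 2)) : ℕ) := by exact_mod_cast hD
  have hfirst : Real.log 2 / 5 * min ((α : ℝ) ^ d) ((L : ℝ) * (K : ℝ) * (α : ℝ) ^ (d - 1)) ≤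
      OverlapCAC.maxEE d H K L r (OverlapCAC.block a α) := by
    refine le_trans ?_ hmain
    rw [hpow, ← min_mul_of_nonneg _ _ (by positivity : (0 : ℝ) ≤ (α : ℝ) ^ (d - 1))]
    push_cast at hD' ⊢
    have := mul_le_mul_of_nonneg_right hD'
      (by positivity : (0 : ℝ) ≤ (α : ℝ) ^ (d - 1) * (Real.log 2 / 5))
    linarith
  refine ⟨hfirst, fun h => ?_⟩
  have h' : (α : ℝ) ≤ L * K := by exact_mod_cast h.le
  rwa [min_eq_left] at hfirst
  rw [hpow]
  exact mul_le_mul_of_nonneg_right h' (by positivity)
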